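/- Let $F$ be a field of characteristic zero and let $E$ be the (unital) Grassmann algebra of an $F$-vector space $L$ with a countably infinite basis $e_1,e_2,\ldots$. Let $G$ be an abelian group, written multiplicatively, and $H\leq G$. Let $E=\bigoplus_{g\in G}A_g$ be an $H$-central $G$-grading, that is, a $G$-grading such that every $e_i$ is homogeneous, $A_g\neq 0$ for every $g\in G$, and for every $h\in H$ the component $A_h$ contains infinitely many monomials $e_{i_1}\cdots e_{i_k}$ of even length $k$ with pairwise disjoint supports $\{e_{i_1},\ldots,e_{i_k}\}$. Let $B=\bigoplus_{\overline g\in G/H}A_{\overline g}$, with $A_{\overline g}=\bigoplus_{h\in H}A_{gh}$, be $E$ with the induced $G/H$-grading. For a group $K$, let $F\langle X|K\rangle$ be the free associative unital algebra on the variables $x_i^{k}$ of degree $k$ ($k\in K$, $i\in\mathbb{N}$), and for a $K$-graded algebra $C=\bigoplus_{k\in K}C_k$ let $T_K(C)$ be its ideal of $K$-graded identities, that is, the set of all $f\in F\langle X|K\rangle$ that vanish whenever each variable $x_i^k$ is replaced by an element of $C_k$. Put $I=T_{G/H}(B)$. (1) There is an injective map from the variables of $F\langle X|G\rangle$ to the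 variables of $F\langle X|G/H\rangle$ that sends each variable of degree $g$ to a variable of degree $\overline g$. For each such injective map, if $\pi\colon F\langle X|G\rangle\to F\langle X|G/H\rangle$ denotes the homomorphism of algebras that extends it, then \[T_G(E)=\{f\in F\langle X|G\rangle\mid \pi(f)\in I\}.\] (2) Let $\pi_H\colon F\langle X|G\rangle\to F\langle X|G/H\rangle$ be the homomorphism with $\pi_H(x_i^g)=x_i^{\overline g}$. Then $\pi_H(f)\in I$ for every $f\in T_G(E)$. If $V$ is a set of variables on which $\pi_H$ is injective and $f$ is a polynomial in variables from $V$, then $f\in T_G(E)$ if and only if $\pi_H(f)\in I$. -/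

import Mathlib

/-- The Grassmann algebra `E` of a vector space with countably infinite basis `e₀, e₁, …`. -/
abbrev Grassmann (F : Type*) [Field F] : Type _ := ExteriorAlgebra F (ℕ →₀ F)

namespace Grassmann

/-- The generator `e i` of the Grassmann algebra. -/
noncomputable def e (F : Type*) [Field F] (i : ℕ) : Grassmann F :=
  ExteriorAlgebra.ι F (Finsupp.single i (1 : F))

/-- The monomial `e_{i₁} ⋯ e_{iₖ}` with support `s = {i₁ < ⋯ < iₖ}`; its length is `s.card`. -/
noncomputable def monomial (F : Type*) [Field F] (s : Finset ℕ) : Grassmann F :=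
  ((s.sort (· ≤ ·)).map (e F)).prod

/-- A `G`-grading `𝒜` of the Grassmann algebra is `H`-central if every generator is homogeneous,
the support is all of `G`, and for every `h ∈ H` the component `𝒜 h` contains infinitely many
monomials of even length with pairwise disjoint supports. -/
structure IsCentralGrading {F G : Type*} [Field F] [AddCommGroup G] [DecidableEq G]
    (H : AddSubgroup G) (𝒜 : G → Submodule F (Grassmann F)) [GradedAlgebra 𝒜] : Prop where
  homogeneous : ∀ i : ℕ, SetLike.IsHomogeneousElem 𝒜 (e F i)
  fullSupport : ∀ g : G, 𝒜 g ≠ ⊥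
  central : ∀ h ∈ H, ∃ S : Set (Finset ℕ), S.Infinite ∧
    (∀ s ∈ S, Even s.card ∧ monomial F s ∈ 𝒜 h) ∧ S.PairwiseDisjoint id

end Grassmann

/-- The free associative unital algebra `F⟨X | G⟩`: the generator `(g, i)` is the variable
`x_i^g`, of degree `g`. -/
abbrev FreeGradedAlgebra (F G : Type*) [Field F] : Type _ := FreeAlgebra F (G × ℕ)

/-- The set `T_G(A)` of `G`-graded polynomial identities of an algebra `A` with components
`𝒜 g`: the polynomials which vanish under all substitutions `x_i^g ↦ a (g, i) ∈ 𝒜 g`. -/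
def gradedIdentities {F G A : Type*} [Field F] [Ring A] [Algebra F A]
    (𝒜 : G → Submodule F A) : Set (FreeGradedAlgebra F G) :=
  {f | ∀ a : G × ℕ → A, (∀ v : G × ℕ, a v ∈ 𝒜 v.1) → FreeAlgebra.lift F a f = 0}

/-- The induced `G ⧸ H`-grading: the component of a coset is the sum of the components of its
elements. -/
def quotientGrading {F G A : Type*} [Field F] [AddCommGroup G] [Ring A] [Algebra F A]
    (H : AddSubgroup G) (𝒜 : G → Submodule F A) (q : G ⧸ H) : Submodule F A :=
  ⨆ (g : G) (_ : (g : G ⧸ H) = q), 𝒜 g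

/-- The effect on variables of the projection to `F⟨X | G ⧸ H⟩`: the variable `x_i^g` goes to the
variable of degree `g + H` whose index is `σ (g, i)`. -/
def projVar {G : Type*} [AddCommGroup G] (H : AddSubgroup G) (σ : G × ℕ → ℕ) (v : G × ℕ) :
    (G ⧸ H) × ℕ :=
  ((v.1 : G ⧸ H), σ v)

/-- The homomorphism `F⟨X | G⟩ → F⟨X | G ⧸ H⟩` that acts on the variables by `projVar H σ`. With
`σ = Prod.snd` it is `x_i^g ↦ x_i^{g + H}`. -/
noncomputable def proj {F G : Type*} [Field F] [AddCommGroup G] (H : AddSubgroup G)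
    (σ : G × ℕ → ℕ) : FreeGradedAlgebra F G →ₐ[F] FreeGradedAlgebra F (G ⧸ H) :=
  FreeAlgebra.lift F fun v => FreeAlgebra.ι F (projVar H σ v)

/-!
A graded identity has to be shown to vanish on substitutions whose values are sums of homogeneous
elements of degrees in one coset of `H`. One degree `g + h` at a time, let `a + b` be the
substitution with `b` of degree `g + h`. For central `w` of degree `-h` the value `a + b * w` is
already allowed, so the polynomial `p(T) = f(a + b * T)` vanishes at every such `w`, and `f(a + b)`
is `p(1)`. It suffices that `p = 0`. Let `w` and `z` be central of degree `-h` with `z ^ 2 = 0`.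
Then `0 = p(w + z) = p(w) + p'(w) * z = p'(w) * z`. In the Grassmann algebra `z` can be an even
monomial disjoint from all monomials of `p'(w)`, whence `p'(w) = 0`. So `p'` vanishes at the same
points as `p`, by induction on the degree `p' = 0`, and in characteristic zero `p` is the constant
`p(0) = 0`.
-/

open Polynomial

section PolynomialUniqueness

/-- A subset `W` of a ring is a uniqueness set for polynomials if `0` is the only polynomial that
vanishes at all points of `W`, so that an identity in one parameter can be checked on `W`. Over a
noncommutative ring the coefficients are written on the left of the powers of the variable, as in
`Polynomial.eval`. -/
def IsPolynomialUniquenessSet {R : Type*} [Ring R] (W : Set R) : Prop :=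
  ∀ p : R[X], (∀ w ∈ W, p.eval w = 0) → p = 0

theorem add_pow_succ_of_mul_self_eq_zero {R : Type*} [Semiring R] {w z : R} (hwz : Commute w z)
    (hz : z * z = 0) (n : ℕ) : (w + z) ^ (n + 1) = w ^ (n + 1) + (n + 1 : ℕ) * w ^ n * z := by
  induction n with
  | zero => simp
  | succ n ih =>
    calc (w + z) ^ (n + 2)
        = w ^ (n + 1) * w + w ^ (n + 1) * z + (n + 1 : ℕ) * (w ^ n * (z * w))
            + (n + 1 : ℕ) * w ^ n * (z * z) := by
          rw [pow_succ, ih]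
          simp only [mul_add, add_mul, mul_assoc]
          abel
      _ = w ^ (n + 1) * w + (w ^ (n + 1) * z + (n + 1 : ℕ) * (w ^ (n + 1) * z)) := by
          rw [← hwz.eq, hz, mul_zero, add_zero, add_assoc, ← mul_assoc (w ^ n), ← pow_succ w n]
      _ = w ^ (n + 2) + (n + 2 : ℕ) * w ^ (n + 1) * z := by
          rw [← pow_succ, ← one_add_mul, mul_assoc, ← Nat.cast_one_add, add_comm 1 (n + 1)]

theorem eval_add_of_mul_self_eq_zero {R : Type*} [Semiring R] {w z : R} (hwz : Commute w z)
    (hz : z * z = 0) (p : R[X]) :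
    p.eval (w + z) = p.eval w + p.derivative.eval w * z := by
  induction p using Polynomial.induction_on' with
  | add p q hp hq =>
    simp only [eval_add, derivative_add, hp, hq, add_mul]
    abel
  | monomial n a =>
    cases n with
    | zero => simp
    | succ n =>
      rw [derivative_monomial, eval_monomial, eval_monomial, eval_monomial,
        add_pow_succ_of_mul_self_eq_zero hwz hz, mul_add, Nat.add_sub_cancel]
      simp only [mul_assoc]

theorem isPolynomialUniquenessSet_of_mul_self_eq_zero {R : Type*} [Ring R] [IsAddTorsionFree R]
    {W : AddSubmonoid R} (hcomm : ∀ w ∈ W, ∀ z ∈ W, Commute w z)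
    (hW : ∀ x : R, x ≠ 0 → ∃ z ∈ W, z * z = 0 ∧ x * z ≠ 0) :
    IsPolynomialUniquenessSet (W : Set R) := by
  intro p hp
  induction hn : p.natDegree using Nat.strong_induction_on generalizing p with
  | _ n ih =>
  have hderiv : ∀ w ∈ W, p.derivative.eval w = 0 := by
    intro w hw
    by_contra hne
    obtain ⟨z, hz, hzz, hmul⟩ := hW _ hne
    refine hmul ?_
    have htaylor := eval_add_of_mul_self_eq_zero (hcomm w hw z hz) hzz p
    rwa [hp _ (add_mem hw hz), hp w hw, zero_add, eq_comm] at htaylor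
  have hconst : p.natDegree = 0 := by
    by_contra hdeg
    exact hdeg (derivative_eq_zero.1 (ih _ (hn ▸ natDegree_derivative_lt hdeg) _ hderiv rfl))
  have hzero := hp 0 W.zero_mem
  rw [eq_C_of_natDegree_eq_zero hconst, eval_C] at hzero
  rw [eq_C_of_natDegree_eq_zero hconst, hzero, C_0]

end PolynomialUniqueness

section FreeAlgebra

variable {R X A : Type*} [CommSemiring R]

theorem freeAlgebra_lift_eq_of_mem_adjoin [Semiring A] [Algebra R A] {V : Set X} {c c' : X → A}
    (hcc' : Set.EqOn c c' V) {f : FreeAlgebra R X}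
    (hf : f ∈ Algebra.adjoin R (FreeAlgebra.ι R '' V)) :
    FreeAlgebra.lift R c f = FreeAlgebra.lift R c' f := by
  refine AlgHom.adjoin_le_equalizer (FreeAlgebra.lift R c) (FreeAlgebra.lift R c') ?_ hf
  rintro _ ⟨v, hv, rfl⟩
  simpa only [FreeAlgebra.lift_ι_apply] using hcc' hv

theorem exists_finset_mem_adjoin_image_ι (f : FreeAlgebra R X) :
    ∃ V : Finset X, f ∈ Algebra.adjoin R (FreeAlgebra.ι R '' (V : Set X)) := by
  classical
  have hmono : ∀ {V W : Finset X}, V ⊆ W →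
      Algebra.adjoin R (FreeAlgebra.ι R '' (V : Set X)) ≤
        Algebra.adjoin R (FreeAlgebra.ι R '' (W : Set X)) :=
    fun h => Algebra.adjoin_mono (Set.image_mono (Finset.coe_subset.2 h))
  induction f using FreeAlgebra.induction with
  | grade0 r => exact ⟨∅, Subalgebra.algebraMap_mem _ r⟩
  | grade1 v => exact ⟨{v}, Algebra.subset_adjoin ⟨v, by simp, rfl⟩⟩
  | mul x y hx hy =>
    obtain ⟨V, hV⟩ := hx
    obtain ⟨W, hW⟩ := hy
    exact ⟨V ∪ W, mul_mem (hmono Finset.subset_union_left hV) (hmono Finset.subset_union_right hW)⟩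
  | add x y hx hy =>
    obtain ⟨V, hV⟩ := hx
    obtain ⟨W, hW⟩ := hy
    exact ⟨V ∪ W, add_mem (hmono Finset.subset_union_left hV) (hmono Finset.subset_union_right hW)⟩

variable [Ring A] [Algebra R A]

theorem eval_freeAlgebra_lift (a b : X → A) {w : A} (hw : ∀ x, Commute x w)
    (f : FreeAlgebra R X) :
    (FreeAlgebra.lift R (fun v => C (a v) + C (b v) * Polynomial.X) f).eval w =
      FreeAlgebra.lift R (fun v => a v + b v * w) f := by
  have hcomp : (eval₂AlgHom (AlgHom.id R A) w hw).comp
      (FreeAlgebra.lift R fun v => C (a v) + C (b v) * Polynomial.X) =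
        FreeAlgebra.lift R fun v => a v + b v * w := by
    ext v
    simp [eval₂AlgHom]
  exact DFunLike.congr_fun hcomp f

theorem freeAlgebra_lift_add_eq_zero {W : Set A} (hW : IsPolynomialUniquenessSet W)
    (hcenter : ∀ w ∈ W, ∀ x, Commute x w) (f : FreeAlgebra R X) {a b : X → A}
    (hf : ∀ w ∈ W, FreeAlgebra.lift R (fun v => a v + b v * w) f = 0) :
    FreeAlgebra.lift R (fun v => a v + b v) f = 0 := by
  have hpoly : FreeAlgebra.lift R (fun v => C (a v) + C (b v) * Polynomial.X) f = 0 :=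
    hW _ fun w hw => (eval_freeAlgebra_lift a b (hcenter w hw) f).trans (hf w hw)
  have hone := eval_freeAlgebra_lift a b Commute.one_right f
  simpa only [hpoly, eval_zero, mul_one, eq_comm] using hone

end FreeAlgebra

section GradedIdentities

/-- The space of central elements of `A` that lie in the component of degree `g`. Multiplication by
such an element shifts degrees by `g`, and it may be substituted into polynomials over `A`. -/
def centralComponent {F G A : Type*} [CommSemiring F] [Semiring A] [Algebra F A]
    (𝒜 : G → Submodule F A) (g : G) : Submodule F A :=
  𝒜 g ⊓ Subalgebra.toSubmodule (Subalgebra.center F A)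

theorem commute_of_mem_centralComponent {F G A : Type*} [CommSemiring F] [Semiring A] [Algebra F A]
    {𝒜 : G → Submodule F A} {g : G} {w : A} (hw : w ∈ centralComponent 𝒜 g) (x : A) :
    Commute x w :=
  Subalgebra.mem_center_iff (R := F).1 hw.2 x

variable {F G A : Type*} [Field F] [AddCommGroup G] [Ring A] [Algebra F A] {H : AddSubgroup G}
  {𝒜 : G → Submodule F A}

theorem le_quotientGrading (H : AddSubgroup G) (𝒜 : G → Submodule F A) (g : G) :
    𝒜 g ≤ quotientGrading H 𝒜 (g : G ⧸ H) :=
  le_iSup₂_of_le (f := fun (g' : G) (_ : (g' : G ⧸ H) = g) => 𝒜 g') g rfl le_rfl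

theorem quotientGrading_mk_le (H : AddSubgroup G) (𝒜 : G → Submodule F A) (g : G) :
    quotientGrading H 𝒜 (g : G ⧸ H) ≤ ⨆ h : H, 𝒜 (g + h) := by
  refine iSup₂_le fun g' hg' => ?_
  have hmem : -g + g' ∈ H := QuotientAddGroup.eq.1 hg'.symm
  simpa only [add_neg_cancel_left] using le_iSup (fun h : H => 𝒜 (g + h)) ⟨-g + g', hmem⟩

theorem lift_eq_zero_of_mem_sup_iSup [SetLike.GradedMul 𝒜]
    (hH : ∀ h ∈ H, IsPolynomialUniquenessSet (centralComponent 𝒜 h : Set A))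
    {f : FreeGradedAlgebra F G} (hf : f ∈ gradedIdentities 𝒜) (T : Finset H)
    {c : G × ℕ → A} (hc : ∀ v, c v ∈ 𝒜 v.1 ⊔ ⨆ h ∈ T, 𝒜 (v.1 + h)) :
    FreeAlgebra.lift F c f = 0 := by
  classical
  induction T using Finset.induction_on generalizing c with
  | empty => exact hf c fun v => by simpa using hc v
  | insert h₀ T _ ih =>
    have hsplit : ∀ v, ∃ a ∈ 𝒜 v.1 ⊔ ⨆ h ∈ T, 𝒜 (v.1 + h), ∃ b ∈ 𝒜 (v.1 + h₀), a + b = c v := by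
      intro v
      have hcv := hc v
      rwa [Finset.iSup_insert, sup_comm (𝒜 (v.1 + h₀)), ← sup_assoc, Submodule.mem_sup] at hcv
    choose a ha b hb hab using hsplit
    obtain rfl : (fun v => a v + b v) = c := funext hab
    refine freeAlgebra_lift_add_eq_zero (hH (-h₀) (neg_mem h₀.2))
      (fun _ => commute_of_mem_centralComponent) f fun w hw => ih fun v => ?_
    have hbw : b v * w ∈ 𝒜 v.1 := by
      simpa only [add_neg_cancel_right] using SetLike.mul_mem_graded (hb v) hw.1
    exact add_mem (ha v) (Submodule.mem_sup_left hbw)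

theorem lift_eq_zero_of_mem_quotientGrading [SetLike.GradedMul 𝒜]
    (hH : ∀ h ∈ H, IsPolynomialUniquenessSet (centralComponent 𝒜 h : Set A))
    {f : FreeGradedAlgebra F G} (hf : f ∈ gradedIdentities 𝒜) {c : G × ℕ → A}
    (hc : ∀ v, c v ∈ quotientGrading H 𝒜 (v.1 : G ⧸ H)) :
    FreeAlgebra.lift F c f = 0 := by
  classical
  obtain ⟨V, hfV⟩ := exists_finset_mem_adjoin_image_ι f
  have hfinite : ∀ v, ∃ T : Finset H, c v ∈ ⨆ h ∈ T, 𝒜 (v.1 + h) := fun v =>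
    Submodule.mem_iSup_iff_exists_finset.1 (quotientGrading_mk_le H 𝒜 v.1 (hc v))
  choose T hT using hfinite
  have htrunc : Set.EqOn c (fun v => if v ∈ V then c v else 0) V :=
    fun v hv => (if_pos hv).symm
  rw [freeAlgebra_lift_eq_of_mem_adjoin htrunc hfV]
  refine lift_eq_zero_of_mem_sup_iSup hH hf (V.biUnion T) fun v => ?_
  by_cases hv : v ∈ V
  · have hle : ⨆ h ∈ T v, 𝒜 (v.1 + h) ≤ ⨆ h ∈ V.biUnion T, 𝒜 (v.1 + h) :=
      biSup_mono fun h hh => Finset.mem_biUnion.2 ⟨v, hv, hh⟩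
    rw [if_pos hv]
    exact Submodule.mem_sup_right (hle (hT v))
  · rw [if_neg hv]
    exact zero_mem _

theorem lift_proj (σ : G × ℕ → ℕ) (b : (G ⧸ H) × ℕ → A) (f : FreeGradedAlgebra F G) :
    FreeAlgebra.lift F b (proj H σ f) = FreeAlgebra.lift F (b ∘ projVar H σ) f := by
  have hcomp : (FreeAlgebra.lift F b).comp (proj H σ) = FreeAlgebra.lift F (b ∘ projVar H σ) := by
    ext v
    simp [proj]
  exact DFunLike.congr_fun hcomp f

theorem proj_mem_gradedIdentities [SetLike.GradedMul 𝒜]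
    (hH : ∀ h ∈ H, IsPolynomialUniquenessSet (centralComponent 𝒜 h : Set A)) (σ : G × ℕ → ℕ)
    {f : FreeGradedAlgebra F G} (hf : f ∈ gradedIdentities 𝒜) :
    proj H σ f ∈ gradedIdentities (quotientGrading H 𝒜) := fun b hb =>
  (lift_proj σ b f).trans
    (lift_eq_zero_of_mem_quotientGrading hH hf fun v => hb (projVar H σ v))

theorem mem_gradedIdentities_of_proj_mem {σ : G × ℕ → ℕ} {V : Set (G × ℕ)}
    (hV : Set.InjOn (projVar H σ) V) {f : FreeGradedAlgebra F G}
    (hfV : f ∈ Algebra.adjoin F (FreeAlgebra.ι F '' V))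
    (hf : proj H σ f ∈ gradedIdentities (quotientGrading H 𝒜)) : f ∈ gradedIdentities 𝒜 := by
  intro a ha
  let b : (G ⧸ H) × ℕ → A := Function.extend (V.domRestrict (projVar H σ)) (V.domRestrict a) 0
  have hb_apply : ∀ v : V, b (projVar H σ v) = a v := hV.injective.extend_apply _ _
  have hb_mem : ∀ w, b w ∈ quotientGrading H 𝒜 w.1 := by
    intro w
    by_cases hw : ∃ v, V.domRestrict (projVar H σ) v = w
    · obtain ⟨v, rfl⟩ := hw
      rw [Set.domRestrict_apply, hb_apply]
      exact le_quotientGrading H 𝒜 v.1.1 (ha v)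
    · rw [show b w = 0 from Function.extend_apply' _ _ _ hw]
      exact zero_mem _
  have hagree : Set.EqOn a (b ∘ projVar H σ) V := fun v hv => (hb_apply ⟨v, hv⟩).symm
  rw [freeAlgebra_lift_eq_of_mem_adjoin hagree hfV, ← lift_proj]
  exact hf b hb_mem

theorem exists_injective_projVar (H : AddSubgroup G) [Countable H] :
    ∃ σ : G × ℕ → ℕ, Function.Injective (projVar H σ) := by
  let offset : G → H := fun g =>
    ⟨-(g : G ⧸ H).out + g, QuotientAddGroup.eq.1 (QuotientAddGroup.out_eq' (g : G ⧸ H))⟩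
  obtain ⟨code, hcode⟩ := exists_injective_nat (H × ℕ)
  refine ⟨fun v => code (offset v.1, v.2), fun ⟨g, i⟩ ⟨g', i'⟩ heq => ?_⟩
  obtain ⟨hcoset, hindex⟩ := Prod.ext_iff.1 heq
  obtain ⟨hoffset, rfl⟩ := Prod.ext_iff.1 (hcode hindex)
  have hsub : -(g : G ⧸ H).out + g = -(g' : G ⧸ H).out + g' := congrArg Subtype.val hoffset
  rw [show (g : G ⧸ H) = g' from hcoset, add_right_inj] at hsub
  rw [hsub]

end GradedIdentities

section ExteriorAlgebra

variable {R M I : Type*} [CommRing R] [AddCommGroup M] [Module R M]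

theorem semiconjBy_ι_prod_map_ι (m : M) (l : List M) :
    SemiconjBy (ExteriorAlgebra.ι R m) (l.map (ExteriorAlgebra.ι R)).prod
      ((-1) ^ l.length * (l.map (ExteriorAlgebra.ι R)).prod) := by
  induction l with
  | nil => simp
  | cons n l ih =>
    have hswap : SemiconjBy (ExteriorAlgebra.ι R m) (ExteriorAlgebra.ι R n)
        (-ExteriorAlgebra.ι R n) := by
      rw [SemiconjBy, neg_mul]
      exact eq_neg_of_add_eq_zero_left (ExteriorAlgebra.ι_add_mul_swap m n)
    have hsign : Commute (ExteriorAlgebra.ι R n) ((-1) ^ l.length) :=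
      (Commute.one_right _).neg_right.pow_right _
    rw [List.map_cons, List.prod_cons, List.length_cons, pow_succ, mul_neg_one, neg_mul,
      ← mul_assoc, ← hsign.eq, mul_assoc, ← neg_mul]
    exact hswap.mul_right ih

theorem commute_prod_map_ι_of_even {l : List M} (hl : Even l.length) (x : ExteriorAlgebra R M) :
    Commute x (l.map (ExteriorAlgebra.ι R)).prod := by
  induction x using ExteriorAlgebra.induction with
  | algebraMap r => exact Algebra.commutes r _
  | ι m => simpa only [hl.neg_one_pow, one_mul, Commute] using semiconjBy_ι_prod_map_ι m l
  | mul a b ha hb => exact ha.mul_left hb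
  | add a b ha hb => exact ha.add_left hb

variable [LinearOrder I] (b : Module.Basis I R M)

theorem exteriorBasis_mul_self {s : Finset I} (hs : s.Nonempty) :
    b.ExteriorAlgebra s * b.ExteriorAlgebra s = 0 := by
  let s' : Set.powersetCard I s.card := Set.powersetCard.ofCard rfl
  have hs' : ¬ Disjoint s'.val s'.val := by
    rw [disjoint_self]
    exact hs.ne_empty
  exact ExteriorAlgebra.basis_mul_of_not_disjoint b s' s' hs'

theorem exists_units_smul_exteriorBasis_mul {s t : Finset I} (hst : Disjoint s t) :
    ∃ ε : ℤˣ, b.ExteriorAlgebra s * b.ExteriorAlgebra t = ε • b.ExteriorAlgebra (s ∪ t) := by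
  let s' : Set.powersetCard I s.card := Set.powersetCard.ofCard rfl
  let t' : Set.powersetCard I t.card := Set.powersetCard.ofCard rfl
  refine ⟨(Set.powersetCard.permOfDisjoint (s := s') (t := t') hst).sign, ?_⟩
  rw [← Finset.disjUnion_eq_union s t hst]
  exact ExteriorAlgebra.basis_mul_of_disjoint b s' t' hst

theorem mul_exteriorBasis_ne_zero {s : Finset I} {x : ExteriorAlgebra R M} (hx : x ≠ 0)
    (hxs : ∀ t ∈ (b.ExteriorAlgebra.repr x).support, Disjoint t s) :
    x * b.ExteriorAlgebra s ≠ 0 := by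
  set B := b.ExteriorAlgebra
  have hunit : ∀ t, Disjoint t s → ∃ ε : ℤˣ, B t * B s = ε • B (t ∪ s) := fun t =>
    exists_units_smul_exteriorBasis_mul b
  obtain ⟨t, ht⟩ : (B.repr x).support.Nonempty := by simpa using hx
  have hcoord : B.repr (x * B s) (t ∪ s) = B.repr x t * B.repr (B t * B s) (t ∪ s) := by
    conv_lhs => rw [← B.linearCombination_repr x, Finsupp.linearCombination_apply, Finsupp.sum,
      Finset.sum_mul, map_sum, Finsupp.finsetSum_apply]
    rw [Finset.sum_eq_single_of_mem t ht]
    · simp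
    · intro u hu hut
      have hne : u ∪ s ≠ t ∪ s := fun h => hut <| by
        rw [← Finset.union_sdiff_cancel_right (hxs u hu), h,
          Finset.union_sdiff_cancel_right (hxs t ht)]
      obtain ⟨ε, hε⟩ := hunit u (hxs u hu)
      rw [smul_mul_assoc, hε]
      rcases Int.units_eq_one_or ε with rfl | rfl <;> simp [hne]
  intro hzero
  obtain ⟨ε, hε⟩ := hunit t (hxs t ht)
  rw [hzero, hε] at hcoord
  refine Finsupp.mem_support_iff.1 ht ?_
  rcases Int.units_eq_one_or ε with rfl | rfl <;> simpa using hcoord.symm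

end ExteriorAlgebra

theorem countable_setOf_ne_bot_of_iSupIndep {R M κ ι : Type*} [Ring R] [IsDomain R]
    [StrongRankCondition R] [AddCommGroup M] [Module R M] [Countable κ] (b : Module.Basis κ R M)
    {V : ι → Submodule R M} (hV : iSupIndep V) : {i | V i ≠ ⊥}.Countable := by
  have := b.isTorsionFree
  have hrank : Module.rank R M ≤ Cardinal.aleph0 := by
    rw [← Cardinal.lift_le_aleph0, ← b.mk_eq_rank, Cardinal.lift_le_aleph0]
    exact Cardinal.mk_le_aleph0
  have hcard := hV.subtype_ne_bot_le_rank.trans (Cardinal.lift_le_aleph0.2 hrank)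
  exact Cardinal.mk_le_aleph0_iff.1 (Cardinal.lift_le_aleph0.1 hcard)

theorem finite_setOf_not_disjoint {I : Type*} {S : Set (Finset I)} (hS : S.PairwiseDisjoint id)
    (t : Finset I) : {s ∈ S | ¬ Disjoint s t}.Finite := by
  have hsub : {s ∈ S | ¬ Disjoint s t} ⊆ ⋃ i ∈ t, {s ∈ S | i ∈ s} := by
    rintro s ⟨hs, hst⟩
    obtain ⟨i, his, hit⟩ := Finset.not_disjoint_iff.1 hst
    exact Set.mem_biUnion hit ⟨hs, his⟩
  refine (t.finite_toSet.biUnion fun i _ => Set.Subsingleton.finite ?_).subset hsub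
  rintro s ⟨hs, his⟩ s' ⟨hs', his'⟩
  exact hS.elim_finset hs hs' i his his'

theorem exists_nonempty_disjoint_of_pairwiseDisjoint {I : Type*} {S : Set (Finset I)}
    (hS : S.PairwiseDisjoint id) (hinf : S.Infinite) (t : Finset I) :
    ∃ s ∈ S, s.Nonempty ∧ Disjoint s t := by
  obtain ⟨s, ⟨hs, hst⟩, hne⟩ :=
    (hinf.sdiff (finite_setOf_not_disjoint hS t)).exists_notMem_finite (Set.finite_singleton ∅)
  exact ⟨s, hs, Finset.nonempty_iff_ne_empty.2 hne, not_not.1 fun h => hst ⟨hs, h⟩⟩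

namespace Grassmann

variable {F : Type*} [Field F]

theorem monomial_eq_prod_map_ι (s : Finset ℕ) :
    monomial F s = (((s.sort (· ≤ ·)).map fun i => Finsupp.single i (1 : F)).map
      (ExteriorAlgebra.ι F)).prod := by
  rw [List.map_map]
  rfl

theorem commute_monomial_of_even {s : Finset ℕ} (hs : Even s.card) (x : Grassmann F) :
    Commute x (monomial F s) := by
  rw [monomial_eq_prod_map_ι]
  exact commute_prod_map_ι_of_even (by simpa using hs) x

theorem monomial_eq_exteriorBasis (s : Finset ℕ) :
    monomial F s = Finsupp.basisSingleOne.ExteriorAlgebra s := by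
  have hlist : (s.sort (· ≤ ·)).map (e F) =
      List.ofFn fun i => e F (s.orderEmbOfFin rfl i) := by
    refine List.ext_getElem (by simp) fun i _ _ => ?_
    simp [Finset.orderEmbOfFin_apply]
  rw [ExteriorAlgebra.basis_apply_ofCard _ rfl, ExteriorAlgebra.ιMulti_family,
    ExteriorAlgebra.ιMulti_apply, monomial, hlist]
  simp only [Function.comp_apply, Finsupp.coe_basisSingleOne]
  rfl

variable {G : Type*} [AddCommGroup G] [DecidableEq G] {H : AddSubgroup G}
  {𝒜 : G → Submodule F (Grassmann F)} [GradedAlgebra 𝒜]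

theorem IsCentralGrading.countable (h𝒜 : IsCentralGrading H 𝒜) : Countable G := by
  have hindep := (DirectSum.Decomposition.isInternal 𝒜).submodule_iSupIndep
  have hcount := countable_setOf_ne_bot_of_iSupIndep
    (Finsupp.basisSingleOne (R := F) (ι := ℕ)).ExteriorAlgebra hindep
  exact Set.countable_univ_iff.1 (hcount.mono fun g _ => h𝒜.fullSupport g)

theorem IsCentralGrading.isPolynomialUniquenessSet_centralComponent [CharZero F]
    (h𝒜 : IsCentralGrading H 𝒜) {h : G} (hh : h ∈ H) :
    IsPolynomialUniquenessSet (centralComponent 𝒜 h : Set (Grassmann F)) := by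
  have : IsAddTorsionFree (Grassmann F) := IsAddTorsionFree.of_isTorsionFree F _
  obtain ⟨S, hinf, hS, hdisj⟩ := h𝒜.central h hh
  refine isPolynomialUniquenessSet_of_mul_self_eq_zero (W := (centralComponent 𝒜 h).toAddSubmonoid)
    (fun w _ z hz => commute_of_mem_centralComponent hz w) fun x hx => ?_
  let B := (Finsupp.basisSingleOne (R := F) (ι := ℕ)).ExteriorAlgebra
  obtain ⟨s, hs, hne, hsx⟩ :=
    exists_nonempty_disjoint_of_pairwiseDisjoint hdisj hinf ((B.repr x).support.biUnion id)
  obtain ⟨heven, hmem⟩ := hS s hs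
  have hcenter : monomial F s ∈ Subalgebra.center F (Grassmann F) :=
    Subalgebra.mem_center_iff.2 (commute_monomial_of_even heven)
  refine ⟨monomial F s, ⟨hmem, hcenter⟩, ?_⟩
  rw [monomial_eq_exteriorBasis]
  exact ⟨exteriorBasis_mul_self _ hne, mul_exteriorBasis_ne_zero _ hx fun t ht =>
    ((Finset.disjoint_biUnion_right ..).1 hsx t ht).symm⟩

end Grassmann

theorem mainTheorem3_general {F G A : Type*} [Field F] [AddCommGroup G] [Ring A] [Algebra F A]
    (H : AddSubgroup G) [Countable H] (𝒜 : G → Submodule F A) [SetLike.GradedMul 𝒜]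
    (hH : ∀ h ∈ H, IsPolynomialUniquenessSet (centralComponent 𝒜 h : Set A)) :
    (∃ σ : G × ℕ → ℕ, Function.Injective (projVar H σ)) ∧
    (∀ σ : G × ℕ → ℕ, Function.Injective (projVar H σ) →
      gradedIdentities 𝒜 =
        {f | proj H σ f ∈ gradedIdentities (quotientGrading H 𝒜)}) ∧
    (∀ f ∈ gradedIdentities 𝒜,
      proj H Prod.snd f ∈ gradedIdentities (quotientGrading H 𝒜)) ∧
    (∀ V : Set (G × ℕ), Set.InjOn (projVar H Prod.snd) V →
      ∀ f ∈ Algebra.adjoin F (FreeAlgebra.ι F '' V),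
        (f ∈ gradedIdentities 𝒜 ↔
          proj H Prod.snd f ∈ gradedIdentities (quotientGrading H 𝒜))) := by
  refine ⟨exists_injective_projVar H, fun σ hσ => Set.Subset.antisymm
    (fun f => proj_mem_gradedIdentities hH σ) (fun f => ?_),
    fun f => proj_mem_gradedIdentities hH Prod.snd, fun V hV f hfV =>
    ⟨proj_mem_gradedIdentities hH Prod.snd, mem_gradedIdentities_of_proj_mem hV hfV⟩⟩
  refine mem_gradedIdentities_of_proj_mem (V := Set.univ) hσ.injOn ?_
  rw [Set.image_univ, FreeAlgebra.adjoin_range_ι]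
  exact Algebra.mem_top

theorem mainTheorem3 {F G : Type*} [Field F] [CharZero F] [AddCommGroup G] [DecidableEq G]
    (H : AddSubgroup G) (𝒜 : G → Submodule F (Grassmann F)) [GradedAlgebra 𝒜]
    (h𝒜 : Grassmann.IsCentralGrading H 𝒜) :
    -- the variables can be relabelled so that distinct ones have distinct images
    (∃ σ : G × ℕ → ℕ, Function.Injective (projVar H σ)) ∧
    -- for every such relabelling
    (∀ σ : G × ℕ → ℕ, Function.Injective (projVar H σ) →
      gradedIdentities 𝒜 =
        {f | proj H σ f ∈ gradedIdentities (quotientGrading H 𝒜)}) ∧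
    -- the map that keeps the index of each variable
    (∀ f ∈ gradedIdentities 𝒜,
      proj H Prod.snd f ∈ gradedIdentities (quotientGrading H 𝒜)) ∧
    (∀ V : Set (G × ℕ), Set.InjOn (projVar H Prod.snd) V →
      ∀ f ∈ Algebra.adjoin F (FreeAlgebra.ι F '' V),
        (f ∈ gradedIdentities 𝒜 ↔
          proj H Prod.snd f ∈ gradedIdentities (quotientGrading H 𝒜))) := by
  have := h𝒜.countable
  exact mainTheorem3_general H 𝒜 fun _ => h𝒜.isPolynomialUniquenessSet_centralComponent
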